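/- Let $N\ge 1$, let $g,h\in\mathbb R$ with $h\neq 0$, and let $v:\mathbb Z\to\mathbb R$ be bounded with $v(n)\to 0$ as $n\to\pm\infty$. On $\ell^2(\mathbb Z)$ with canonical basis $(e_j)_{j\in\mathbb Z}$ let $Xe_j=j\,e_j$, $\Delta e_j=-(e_{j-1}+e_{j+1})$ and $H_0=g\Delta-2hX$. On $\ell^2(\mathbb Z)^{\otimes N}=\ell^2(\mathbb Z^N)$ let $$H^{(N)}=\sum_{i=1}^N 1\otimes\cdots\otimes \underbrace{H_0}_{i}\otimes\cdots\otimes 1+\sum_{1\le i<k\le N}v(x_i-x_k)$$ be the self-adjoint $N$-particle Stark Hamiltonian (with domain the domain of $X_1+\cdots+X_N$), where $v(x_i-x_k)$ acts by multiplication. For $m\in\mathbb Z$ let $\xi^{(m)}\in\ell^2(\mathbb Z)$, $\xi^{(m)}_j=\mathcal J_{m-j}(g/h)$ ($\mathcal J_n$ the Bessel function of the first kind of order $n$), be the normalized eigenvector of $H_0$ with eigenvalue $-2hm$, and write $|m_1,\dots,m_N\rangle=\xi^{(m_1)}\otimes\cdots\otimes\xi^{(m_N)}$. Then: (1) For every $\theta\ge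 0$ there is a constant $C(\theta)$ such that for every eigenvalue $\lambda$ of $H^{(N)}$, every corresponding normalized eigenvector $\psi_\lambda$ and all $m_1,\dots,m_N\in\mathbb Z$, $$|\langle\psi_\lambda\mid m_1,\dots,m_N\rangle|\le C(\theta)\exp\Big(-\theta\,\Big|\sum_i m_i+\frac{\lambda}{2h}\Big|\Big).$$ (2) For every $\theta>0$ there is a constant $C(\theta)$ such that for every eigenvalue $\lambda$ of $H^{(N)}$, every corresponding normalized eigenvector $\psi_\lambda$ and all $j_1,\dots,j_N\in\mathbb Z$, $$|\langle\psi_\lambda\mid e_{j_1}\otimes\cdots\otimes e_{j_N}\rangle|\le C(\theta)\exp\Big(-\theta\,\Big|\sum_i j_i+\frac{\lambda}{2h}\Big|\Big).$$ The constants may depend on $N,g,h,v,\theta$ but not on $\lambda$ or $\psi_\lambda$. So every eigenvector decays superexponentially in the center-of-mass direction, uniformly in $\lambda$. In energy units with $-2h=1$ the exponents are $-\theta|\sum_i m_i-\lambda|$ and $-\theta|\sum_i j_i-\lambda|$. -/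

import Mathlib

open scoped ENNReal

noncomputable section

namespace StarkFewBody

/-- Configurations `(j₁, …, j_N) ∈ ℤ^N` of `N` particles on the lattice `ℤ`. -/
abbrev Config (N : ℕ) : Type := Fin N → ℤ

/-- The one-particle Hilbert space `ℓ²(ℤ)`. -/
abbrev OneParticle : Type := lp (fun _ : ℤ => ℂ) 2

/-- The `N`-particle Hilbert space `ℓ²(ℤ)^{⊗N} = ℓ²(ℤ^N)`. -/
abbrev HilbertSpace (N : ℕ) : Type := lp (fun _ : Config N => ℂ) 2

/-- The one-particle Stark Hamiltonian `H₀ = g Δ - 2 h X` acting on the `i`-th particle, where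
`Δ e_j = -(e_{j-1} + e_{j+1})` and `X e_j = j e_j`, as a formal difference expression. -/
def starkAction {N : ℕ} (g h : ℝ) (i : Fin N) (ψ : Config N → ℂ) : Config N → ℂ := fun j =>
  (g : ℂ) * (-(ψ (j - Pi.single i 1) + ψ (j + Pi.single i 1))) - 2 * (h : ℂ) * (j i : ℂ) * ψ j

/-- The pair interaction `∑_{i<k} V(x_i - x_k)`: multiplication by `∑_{i<k} v(j_i - j_k)`. -/
def pairAction {N : ℕ} (v : ℤ → ℝ) (ψ : Config N → ℂ) : Config N → ℂ := fun j =>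
  ∑ i : Fin N, ∑ k ∈ Finset.Ioi i, (v (j i - j k) : ℂ) * ψ j

/-- The formal expression of `H^{(N)} = ∑_i H₀ (on particle i) + ∑_{i<k} V(x_i - x_k)`. -/
def hamAction {N : ℕ} (g h : ℝ) (v : ℤ → ℝ) (ψ : Config N → ℂ) : Config N → ℂ := fun j =>
  (∑ i : Fin N, starkAction g h i ψ j) + pairAction v ψ j

theorem hamAction_add {N : ℕ} (g h : ℝ) (v : ℤ → ℝ) (ψ φ : Config N → ℂ) :
    hamAction g h v (ψ + φ) = hamAction g h v ψ + hamAction g h v φ := by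
  funext j
  have h1 : ∀ i : Fin N, starkAction g h i (ψ + φ) j
      = starkAction g h i ψ j + starkAction g h i φ j := fun i => by
    simp only [starkAction, Pi.add_apply]; ring
  simp only [hamAction, pairAction, Pi.add_apply, h1, mul_add, Finset.sum_add_distrib]
  ring

theorem hamAction_smul {N : ℕ} (g h : ℝ) (v : ℤ → ℝ) (c : ℂ) (ψ : Config N → ℂ) :
    hamAction g h v (c • ψ) = c • hamAction g h v ψ := by
  funext j
  have h1 : ∀ i : Fin N, starkAction g h i (c • ψ) j = c * starkAction g h i ψ j := fun i => by
    simp only [starkAction, Pi.smul_apply, smul_eq_mul]; ring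
  simp only [hamAction, pairAction, Pi.smul_apply, smul_eq_mul, h1, mul_add, Finset.mul_sum]
  congr 1
  exact Finset.sum_congr rfl fun i _ => Finset.sum_congr rfl fun k _ => by ring

/-- The `N`-particle Hamiltonian `H^{(N)}` as an unbounded operator on `ℓ²(ℤ^N)`, on its maximal
domain `{ψ ∈ ℓ² : H^{(N)} ψ ∈ ℓ²}`. For bounded `v` the hopping terms and the interaction are
bounded operators, so for `h ≠ 0` this domain is the domain of the multiplication operator
`X₁ + ⋯ + X_N` (see `mem_hamiltonian_domain_iff`), and the operator is the (self-adjoint) closure of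
its restriction to finitely supported vectors. -/
def hamiltonian (N : ℕ) (g h : ℝ) (v : ℤ → ℝ) : HilbertSpace N →ₗ.[ℂ] HilbertSpace N where
  domain :=
    { carrier := {ψ | Memℓp (hamAction g h v (ψ : Config N → ℂ)) 2}
      add_mem' := by
        intro ψ φ hψ hφ
        simp only [Set.mem_ofPred_eq, lp.coeFn_add, hamAction_add] at *
        exact hψ.add hφ
      zero_mem' := by
        have h0 : hamAction g h v (0 : Config N → ℂ) = 0 := by
          simpa using hamAction_smul (N := N) g h v 0 0
        simp only [Set.mem_ofPred_eq, lp.coeFn_zero, h0]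
        exact zero_memℓp
      smul_mem' := by
        intro c ψ hψ
        simp only [Set.mem_ofPred_eq, lp.coeFn_smul, hamAction_smul] at *
        exact hψ.const_smul c }
  toFun :=
    { toFun := fun ψ => ⟨hamAction g h v ((ψ : HilbertSpace N) : Config N → ℂ), ψ.2⟩
      map_add' := by
        intro ψ φ
        apply Subtype.ext
        simp only [Submodule.coe_add, lp.coeFn_add, hamAction_add]
        rfl
      map_smul' := by
        intro c ψ
        apply Subtype.ext
        simp only [Submodule.coe_smul, lp.coeFn_smul, hamAction_smul]
        rfl }

theorem memℓp_comp_injective {N : ℕ} {f : Config N → ℂ} (hf : Memℓp f 2)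
    {s : Config N → Config N} (hs : Function.Injective s) : Memℓp (fun j => f (s j)) 2 := by
  refine memℓp_gen ?_
  exact (hf.summable (by norm_num)).comp_injective hs

theorem memℓp_bounded_mul {N : ℕ} {f : Config N → ℂ} (hf : Memℓp f 2) {w : Config N → ℂ} {B : ℝ}
    (hw : ∀ j, ‖w j‖ ≤ B) : Memℓp (fun j => w j * f j) 2 := by
  have h1 : Memℓp (fun j => B * ‖f j‖) 2 := (memℓp_norm_iff.2 hf).const_mul B
  refine h1.mono' fun j => ?_
  have hB : 0 ≤ B := (norm_nonneg _).trans (hw j)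
  rw [norm_mul, Real.norm_of_nonneg (by positivity)]
  gcongr
  exact hw j

/-- The maximal domain is the domain of the total position operator `X₁ + ⋯ + X_N`. -/
theorem mem_hamiltonian_domain_iff {N : ℕ} {g h : ℝ} {v : ℤ → ℝ} (hh : h ≠ 0)
    (hv : ∃ B : ℝ, ∀ n, |v n| ≤ B) (ψ : HilbertSpace N) :
    ψ ∈ (hamiltonian N g h v).domain ↔
      Memℓp (fun j : Config N => (∑ i, (j i : ℂ)) * ψ j) 2 := by
  obtain ⟨B, hB⟩ := hv
  let b : Config N → ℂ := fun j =>
    (∑ i : Fin N, (g : ℂ) * (-(ψ (j - Pi.single i 1) + ψ (j + Pi.single i 1)))) +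
      (∑ i : Fin N, ∑ k ∈ Finset.Ioi i, (v (j i - j k) : ℂ)) * ψ j
  have hb : Memℓp b 2 := by
    refine Memℓp.add (f := fun j : Config N =>
      ∑ i : Fin N, (g : ℂ) * (-(ψ (j - Pi.single i 1) + ψ (j + Pi.single i 1)))) ?_ ?_
    · refine Memℓp.finsetSum _ fun i _ => ?_
      refine Memℓp.const_mul (Memℓp.neg (Memℓp.add ?_ ?_)) _
      · exact memℓp_comp_injective (lp.memℓp ψ) (sub_left_injective)
      · exact memℓp_comp_injective (lp.memℓp ψ) (add_left_injective _)
    · refine memℓp_bounded_mul (B := ∑ i : Fin N, ∑ k ∈ Finset.Ioi i, B) (lp.memℓp ψ) fun j => ?_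
      refine (norm_sum_le _ _).trans (Finset.sum_le_sum fun i _ => ?_)
      refine (norm_sum_le _ _).trans (Finset.sum_le_sum fun k _ => ?_)
      simpa using hB (j i - j k)
  have key : hamAction g h v (ψ : Config N → ℂ) =
      b + (-2 * (h : ℂ)) • (fun j : Config N => (∑ i, (j i : ℂ)) * ψ j) := by
    funext j
    simp only [hamAction, starkAction, pairAction, b, Pi.add_apply, Pi.smul_apply, smul_eq_mul,
      Finset.sum_sub_distrib, Finset.sum_mul, Finset.mul_sum]
    have : ∀ i : Fin N, -2 * (h : ℂ) * ((j i : ℂ) * ψ j) = -(2 * (h : ℂ) * (j i : ℂ) * ψ j) :=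
      fun i => by ring
    simp only [this, Finset.sum_neg_distrib]
    ring
  change Memℓp (hamAction g h v (ψ : Config N → ℂ)) 2 ↔ _
  rw [key]
  have hc : (-2 * (h : ℂ)) ≠ 0 := by simpa using hh
  constructor
  · intro H
    have H2 := (H.sub hb).const_smul (-2 * (h : ℂ))⁻¹
    rwa [add_sub_cancel_left, inv_smul_smul₀ hc] at H2
  · intro H
    exact hb.add (H.const_smul _)

/-- The Bessel function `𝒥_n(x)` of the first kind of integer order `n`:
`𝒥_n(x) = ∑_k (-1)^k / (k! (k + n)!) (x/2)^{2k+n}` for `n ≥ 0`, and `𝒥_{-n} = (-1)^n 𝒥_n`. -/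
def besselJ (n : ℤ) (x : ℝ) : ℝ :=
  (if n < 0 then (-1 : ℝ) ^ n.natAbs else 1) *
    ∑' k : ℕ, (-1 : ℝ) ^ k / (k.factorial * (k + n.natAbs).factorial) *
      (x / 2) ^ (2 * k + n.natAbs)

theorem besselJ_series_norm_le (n : ℕ) (x : ℝ) (k : ℕ) :
    ‖(-1 : ℝ) ^ k / (k.factorial * (k + n).factorial) * (x / 2) ^ (2 * k + n)‖ ≤
      |x / 2| ^ n / n.factorial * (((x / 2) ^ 2) ^ k / k.factorial) := by
  have h1 : (n.factorial : ℝ) ≤ (k + n).factorial := by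
    exact_mod_cast Nat.factorial_le (by omega)
  have h2 : |x / 2| ^ (2 * k + n) = |x / 2| ^ n * ((x / 2) ^ 2) ^ k := by
    rw [pow_add, pow_mul, sq_abs]; ring
  have h3 : (0 : ℝ) < n.factorial := by positivity
  have h4 : (0 : ℝ) < k.factorial := by positivity
  rw [norm_mul, norm_div, norm_pow, norm_neg, norm_one, one_pow, norm_pow, Real.norm_eq_abs (x / 2),
    h2, Real.norm_of_nonneg (by positivity), div_mul_div_comm, one_div_mul_eq_div,
    mul_comm (n.factorial : ℝ)]
  gcongr

theorem abs_besselJ_le (n : ℤ) (x : ℝ) :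
    |besselJ n x| ≤ Real.exp ((x / 2) ^ 2) * (|x / 2| ^ n.natAbs / n.natAbs.factorial) := by
  have hs : HasSum (fun k : ℕ => |x / 2| ^ n.natAbs / n.natAbs.factorial *
      (((x / 2) ^ 2) ^ k / k.factorial))
      (|x / 2| ^ n.natAbs / n.natAbs.factorial * Real.exp ((x / 2) ^ 2)) := by
    have he : HasSum (fun k : ℕ => ((x / 2) ^ 2) ^ k / (k.factorial : ℝ))
        (Real.exp ((x / 2) ^ 2)) := by
      rw [Real.exp_eq_exp_ℝ]
      exact NormedSpace.expSeries_div_hasSum_exp (𝔸 := ℝ) ((x / 2) ^ 2)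
    exact he.mul_left _
  have ht := tsum_of_norm_bounded hs (besselJ_series_norm_le n.natAbs x)
  have hσ : |if n < 0 then (-1 : ℝ) ^ n.natAbs else 1| = 1 := by
    split_ifs <;> simp
  rw [besselJ, abs_mul, hσ, one_mul, mul_comm (Real.exp _)]
  exact ht

theorem summable_abs_besselJ (x : ℝ) : Summable fun n : ℤ => |besselJ n x| := by
  have h : Summable fun n : ℤ =>
      Real.exp ((x / 2) ^ 2) * (|x / 2| ^ n.natAbs / n.natAbs.factorial) := by
    refine Summable.mul_left _ (Summable.of_nat_of_neg ?_ ?_) <;>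
    simpa using Real.summable_pow_div_factorial |x / 2|
  exact h.of_nonneg_of_le (fun _ => abs_nonneg _) fun n => abs_besselJ_le n x

/-- The normalized one-particle Stark eigenvector `ξ^{(m)} ∈ ℓ²(ℤ)`, with coordinates
`ξ^{(m)}_j = 𝒥_{m-j}(g/h)`; it satisfies `H₀ ξ^{(m)} = -2hm ξ^{(m)}`. -/
def starkVec (g h : ℝ) (m : ℤ) : OneParticle :=
  ⟨fun j => (besselJ (m - j) (g / h) : ℂ), by
    refine Memℓp.of_exponent_ge (q := 1) (memℓp_gen ?_) (by norm_num)
    have h1 := (summable_abs_besselJ (g / h)).comp_injective (sub_right_injective (b := m))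
    refine h1.congr fun j => ?_
    simp⟩

theorem summable_prod_pi (N : ℕ) (f : Fin N → ℤ → ℝ) (h0 : ∀ i n, 0 ≤ f i n)
    (hf : ∀ i, Summable (f i)) : Summable fun j : Config N => ∏ i, f i (j i) := by
  induction N with
  | zero => exact Summable.of_finite
  | succ N ih =>
    rw [← (Fin.consEquiv fun _ : Fin (N + 1) => ℤ).summable_iff]
    have h1 := (hf 0).mul_of_nonneg (ih (fun i => f i.succ) (fun i => h0 _) fun i => hf _)
      (h0 0) (fun j => Finset.prod_nonneg fun i _ => h0 _ _)
    refine h1.congr fun p => ?_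
    simp [Fin.prod_univ_succ, Fin.consEquiv]

/-- The elementary tensor `f₁ ⊗ ⋯ ⊗ f_N ∈ ℓ²(ℤ^N)` of vectors of `ℓ²(ℤ)`. -/
def tensorVec {N : ℕ} (f : Fin N → OneParticle) : HilbertSpace N :=
  ⟨fun j => ∏ i, f i (j i), by
    refine memℓp_gen ?_
    have := summable_prod_pi N (fun i n => ‖f i n‖ ^ (2 : ℝ≥0∞).toReal) (fun i n => by positivity)
      fun i => (lp.memℓp (f i)).summable (by norm_num)
    refine this.congr fun j => ?_
    rw [norm_prod, Real.finsetProd_rpow _ _ fun i _ => norm_nonneg _]⟩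

/-- The Stark basis vector `|m₁, …, m_N⟩ = ξ^{(m₁)} ⊗ ⋯ ⊗ ξ^{(m_N)}`. -/
def starkBasis {N : ℕ} (g h : ℝ) (m : Config N) : HilbertSpace N :=
  tensorVec fun i => starkVec g h (m i)

/-- The position basis vector `e_{j₁} ⊗ ⋯ ⊗ e_{j_N}`. -/
def positionBasis {N : ℕ} (j : Config N) : HilbertSpace N :=
  tensorVec fun i => lp.single 2 (j i) (1 : ℂ)

/-- `(lam, ψ)` is a normalized eigenpair of `H^{(N)}`. -/
def IsNormalizedEigenpair {N : ℕ} (g h : ℝ) (v : ℤ → ℝ) (lam : ℂ) (ψ : HilbertSpace N) : Prop :=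
  ‖ψ‖ = 1 ∧ ∃ hψ : ψ ∈ (hamiltonian N g h v).domain, hamiltonian N g h v ⟨ψ, hψ⟩ = lam • ψ

end StarkFewBody

end

/-!
The interaction commutes with the total position `X₁ + ⋯ + X_N`, so the only terms of `H^{(N)}`
linking different values of `∑ᵢ jᵢ` are the bounded nearest-neighbour hops, while the potential
`-2h ∑ᵢ jᵢ` grows linearly. With `d(j) = |∑ᵢ jᵢ + λ / 2h|`, the eigenvalue equation at `j` reads
`(2|h| d(j) - O(1)) |ψ j| ≤ |g| ∑ (|ψ| at the 2N neighbours of j)`, and a hop changes `d` by at most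
one. Hence beyond a radius `R` which depends on `θ` but not on `λ`, each further unit step in `d`
gains a factor `exp (-θ)` (`norm_le_exp_of_radius_le`). Since `|ψ| ≤ 1`, this is the decay in the
position basis.

For the Stark basis, `|𝒥_n|` decays superexponentially in `|n|`, so `∑ |𝒥_n| exp (θ |n|)` is finite
(`summable_abs_besselJ_mul_exp`), and
`exp (-θ d(j)) ≤ exp (-θ d(m)) ∏ᵢ exp (θ |mᵢ - jᵢ|)` turns the pointwise bound on `ψ` into the bound
on `⟨ψ | m⟩ = ∑_j conj (ψ j) ∏ᵢ 𝒥_{mᵢ - jᵢ}`.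
-/

namespace StarkFewBody

/-- The distance `|∑ᵢ jᵢ + λ / 2h|` from the total position of `j` to the value `-λ / 2h` at which
the linear potential equals `λ`. It is defined for every complex `λ`, so that no reality of the
eigenvalues is needed. -/
noncomputable def comDist {N : ℕ} (h : ℝ) (lam : ℂ) (j : Config N) : ℝ :=
  ‖(∑ i, (j i : ℂ)) + lam / (2 * (h : ℂ))‖

theorem comDist_le_add_sum_abs_sub {N : ℕ} (h : ℝ) (lam : ℂ) (j k : Config N) :
    comDist h lam k ≤ comDist h lam j + ∑ i, |((k i - j i : ℤ) : ℝ)| := by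
  have h1 : (∑ i, (k i : ℂ)) + lam / (2 * (h : ℂ)) =
      ((∑ i, (j i : ℂ)) + lam / (2 * (h : ℂ))) + ∑ i, ((k i - j i : ℤ) : ℂ) := by
    push_cast
    rw [Finset.sum_sub_distrib]
    ring
  unfold comDist
  rw [h1]
  refine (norm_add_le _ _).trans (add_le_add le_rfl ((norm_sum_le _ _).trans_eq ?_))
  simp only [Complex.norm_intCast]

theorem comDist_le_sub_single_add_one {N : ℕ} (h : ℝ) (lam : ℂ) (j : Config N) (i : Fin N) :
    comDist h lam j ≤ comDist h lam (j - Pi.single i 1) + 1 := by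
  refine (comDist_le_add_sum_abs_sub h lam (j - Pi.single i 1) j).trans_eq ?_
  simp [Pi.single_apply, apply_ite]

theorem comDist_le_add_single_add_one {N : ℕ} (h : ℝ) (lam : ℂ) (j : Config N) (i : Fin N) :
    comDist h lam j ≤ comDist h lam (j + Pi.single i 1) + 1 := by
  refine (comDist_le_add_sum_abs_sub h lam (j + Pi.single i 1) j).trans_eq ?_
  simp [Pi.single_apply, apply_ite]

/-- A bound on the pair interaction when `|v| ≤ B`. -/
noncomputable def pairBound (N : ℕ) (B : ℝ) : ℝ := ∑ i : Fin N, ∑ _k ∈ Finset.Ioi i, B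

theorem norm_pairAction_le {N : ℕ} {v : ℤ → ℝ} {B : ℝ} (hB : ∀ n, |v n| ≤ B)
    (ψ : Config N → ℂ) (j : Config N) : ‖pairAction v ψ j‖ ≤ pairBound N B * ‖ψ j‖ := by
  simp only [pairAction, pairBound, Finset.sum_mul]
  refine (norm_sum_le _ _).trans (Finset.sum_le_sum fun i _ => ?_)
  refine (norm_sum_le _ _).trans (Finset.sum_le_sum fun k _ => ?_)
  rw [norm_mul, Complex.norm_real]
  exact mul_le_mul_of_nonneg_right (hB _) (norm_nonneg _)

/-- The eigenvalue equation at `j`, with the potential terms compared to the hopping terms. -/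
theorem comDist_mul_norm_le {N : ℕ} {g h : ℝ} (hh : h ≠ 0) {v : ℤ → ℝ} {B : ℝ}
    (hB : ∀ n, |v n| ≤ B) {lam : ℂ} {ψ : Config N → ℂ} {j : Config N}
    (he : hamAction g h v ψ j = lam * ψ j) :
    (2 * |h| * comDist h lam j - pairBound N B) * ‖ψ j‖ ≤
      |g| * ∑ i, (‖ψ (j - Pi.single i 1)‖ + ‖ψ (j + Pi.single i 1)‖) := by
  have hc : (2 * (h : ℂ)) ≠ 0 := by simpa using hh
  have key : (2 * (h : ℂ)) * ((∑ i, (j i : ℂ)) + lam / (2 * (h : ℂ))) * ψ j =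
      pairAction v ψ j -
        (g : ℂ) * ∑ i, (ψ (j - Pi.single i 1) + ψ (j + Pi.single i 1)) := by
    rw [mul_add, mul_div_cancel₀ _ hc, add_mul, ← he]
    simp only [hamAction, starkAction, Finset.sum_sub_distrib, ← Finset.mul_sum,
      ← Finset.sum_mul, Finset.sum_neg_distrib]
    ring
  have h1 : ‖(2 * (h : ℂ)) * ((∑ i, (j i : ℂ)) + lam / (2 * (h : ℂ))) * ψ j‖ =
      2 * |h| * comDist h lam j * ‖ψ j‖ := by
    simp [comDist]
  have h2 : ‖(g : ℂ) * ∑ i, (ψ (j - Pi.single i 1) + ψ (j + Pi.single i 1))‖ ≤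
      |g| * ∑ i, (‖ψ (j - Pi.single i 1)‖ + ‖ψ (j + Pi.single i 1)‖) := by
    rw [norm_mul, Complex.norm_real, Real.norm_eq_abs]
    gcongr
    exact (norm_sum_le _ _).trans (Finset.sum_le_sum fun i _ => norm_add_le _ _)
  have h3 := norm_sub_le (pairAction v ψ j)
    ((g : ℂ) * ∑ i, (ψ (j - Pi.single i 1) + ψ (j + Pi.single i 1)))
  rw [← key, h1] at h3
  have h4 := norm_pairAction_le hB ψ j
  linarith

/-- Beyond a radius `R` at which the linear potential beats the hopping by the factor `exp θ`, each
unit of distance gains a factor `exp (-θ)`. -/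
theorem norm_le_exp_of_radius_le {N : ℕ} {g h : ℝ} (hh : h ≠ 0) {v : ℤ → ℝ} {B θ R : ℝ}
    (hB : ∀ n, |v n| ≤ B)
    (hR : |g| * (N * 2) * Real.exp θ + 1 ≤ 2 * |h| * R - pairBound N B) {lam : ℂ}
    {ψ : Config N → ℂ} (he : ∀ j, hamAction g h v ψ j = lam * ψ j) (h1 : ∀ j, ‖ψ j‖ ≤ 1) (k : ℕ) :
    ∀ j, R + k ≤ comDist h lam j → ‖ψ j‖ ≤ Real.exp (-θ * k) := by
  induction k with
  | zero => intro j _; simpa using h1 j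
  | succ k ih =>
    intro j hj
    push_cast at hj
    have hnb : ∑ i : Fin N, (‖ψ (j - Pi.single i 1)‖ + ‖ψ (j + Pi.single i 1)‖) ≤
        N * 2 * Real.exp (-θ * k) := by
      have hi : ∀ i ∈ (Finset.univ : Finset (Fin N)),
          ‖ψ (j - Pi.single i 1)‖ + ‖ψ (j + Pi.single i 1)‖ ≤ 2 * Real.exp (-θ * k) := by
        intro i _
        have ha := ih (j - Pi.single i 1)
          (by linarith [comDist_le_sub_single_add_one h lam j i])
        have hb := ih (j + Pi.single i 1)
          (by linarith [comDist_le_add_single_add_one h lam j i])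
        linarith
      refine (Finset.sum_le_sum hi).trans_eq ?_
      simp [mul_assoc]
    have hd : 2 * |h| * R ≤ 2 * |h| * comDist h lam j := by
      have : R ≤ comDist h lam j := by linarith [Nat.cast_nonneg (α := ℝ) k]
      gcongr
    have hA : 0 < |g| * (N * 2) * Real.exp θ + 1 := by positivity
    have hexp : Real.exp (-θ * k) = Real.exp θ * Real.exp (-θ * (k + 1 : ℕ)) := by
      rw [← Real.exp_add]; push_cast; ring_nf
    refine le_of_mul_le_mul_left ?_ hA
    calc (|g| * (N * 2) * Real.exp θ + 1) * ‖ψ j‖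
        ≤ (2 * |h| * comDist h lam j - pairBound N B) * ‖ψ j‖ := by
          gcongr; linarith
      _ ≤ |g| * ∑ i, (‖ψ (j - Pi.single i 1)‖ + ‖ψ (j + Pi.single i 1)‖) :=
          comDist_mul_norm_le hh hB (he j)
      _ ≤ |g| * (N * 2 * Real.exp (-θ * k)) := by gcongr
      _ = (|g| * (N * 2) * Real.exp θ) * Real.exp (-θ * (k + 1 : ℕ)) := by rw [hexp]; ring
      _ ≤ _ := by
          gcongr
          linarith

theorem IsNormalizedEigenpair.hamAction_eq {N : ℕ} {g h : ℝ} {v : ℤ → ℝ} {lam : ℂ}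
    {ψ : HilbertSpace N} (H : IsNormalizedEigenpair g h v lam ψ) (j : Config N) :
    hamAction g h v ψ j = lam * ψ j := by
  obtain ⟨-, hψ, he⟩ := H
  exact congrArg (fun φ : HilbertSpace N => φ j) he

theorem IsNormalizedEigenpair.norm_apply_le_one {N : ℕ} {g h : ℝ} {v : ℤ → ℝ} {lam : ℂ}
    {ψ : HilbertSpace N} (H : IsNormalizedEigenpair g h v lam ψ) (j : Config N) :
    ‖ψ j‖ ≤ 1 :=
  (lp.norm_apply_le_norm (by norm_num) ψ j).trans_eq H.1

/-- Pointwise decay of eigenvectors in the centre-of-mass direction, uniformly in `λ`. -/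
theorem exists_norm_apply_le_exp (N : ℕ) (g : ℝ) {h : ℝ} (hh : h ≠ 0) {v : ℤ → ℝ}
    (hv : ∃ B : ℝ, ∀ n, |v n| ≤ B) {θ : ℝ} (hθ : 0 ≤ θ) :
    ∃ C : ℝ, 0 ≤ C ∧ ∀ (lam : ℂ) (ψ : HilbertSpace N), IsNormalizedEigenpair g h v lam ψ →
      ∀ j : Config N, ‖ψ j‖ ≤ C * Real.exp (-θ * comDist h lam j) := by
  obtain ⟨B, hB⟩ := hv
  obtain ⟨R, hR⟩ : ∃ R, |g| * (N * 2) * Real.exp θ + 1 ≤ 2 * |h| * R - pairBound N B := by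
    refine ⟨(|g| * (N * 2) * Real.exp θ + 1 + pairBound N B) / (2 * |h|), ?_⟩
    rw [mul_div_cancel₀ _ (by positivity)]
    linarith
  refine ⟨Real.exp (θ * (R + 1)), (Real.exp_pos _).le, fun lam ψ H j => ?_⟩
  rw [← Real.exp_add]
  rcases le_total R (comDist h lam j) with hj | hj
  · have hf := Nat.floor_le (sub_nonneg.2 hj)
    refine (norm_le_exp_of_radius_le hh hB hR H.hamAction_eq H.norm_apply_le_one
      ⌊comDist h lam j - R⌋₊ j (by linarith)).trans (Real.exp_le_exp.2 ?_)
    have := mul_le_mul_of_nonneg_left (Nat.lt_floor_add_one (comDist h lam j - R)).le hθ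
    linarith
  · refine (H.norm_apply_le_one j).trans (Real.one_le_exp ?_)
    have := mul_nonneg hθ (sub_nonneg.2 hj)
    linarith

theorem inner_positionBasis {N : ℕ} (ψ : HilbertSpace N) (j : Config N) :
    inner ℂ ψ (positionBasis j) = starRingEnd ℂ (ψ j) := by
  have h1 : positionBasis j = lp.single 2 j (1 : ℂ) := by
    ext k
    by_cases hk : k = j
    · subst hk
      simp [positionBasis, tensorVec]
    · obtain ⟨i, hi⟩ := Function.ne_iff.1 hk
      have h2 : (positionBasis j : Config N → ℂ) k = 0 :=
        Finset.prod_eq_zero (Finset.mem_univ i) (by simp [hi])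
      rw [h2, lp.single_apply_ne _ _ _ hk]
  rw [h1, lp.inner_single_right]
  simp

theorem summable_abs_besselJ_mul_exp (x θ : ℝ) :
    Summable fun n : ℤ => |besselJ n x| * Real.exp (θ * |(n : ℝ)|) := by
  have h : Summable fun n : ℤ =>
      Real.exp ((x / 2) ^ 2) * ((|x / 2| * Real.exp θ) ^ n.natAbs / n.natAbs.factorial) := by
    refine Summable.mul_left _ (Summable.of_nat_of_neg ?_ ?_) <;>
    simpa using Real.summable_pow_div_factorial (|x / 2| * Real.exp θ)
  refine h.of_nonneg_of_le (fun _ => by positivity) fun n => ?_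
  have he : Real.exp (θ * |(n : ℝ)|) = Real.exp θ ^ n.natAbs := by
    rw [← Real.exp_nat_mul, Nat.cast_natAbs, Int.cast_abs, mul_comm]
  rw [he, mul_pow, mul_div_right_comm, ← mul_assoc]
  exact mul_le_mul_of_nonneg_right (abs_besselJ_le n x) (by positivity)

theorem summable_prod_besselJ_mul_exp (N : ℕ) (x θ : ℝ) :
    Summable fun n : Config N => ∏ i, (|besselJ (n i) x| * Real.exp (θ * |(n i : ℝ)|)) :=
  summable_prod_pi N (fun _ n => |besselJ n x| * Real.exp (θ * |(n : ℝ)|))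
    (fun _ _ => by positivity) fun _ => summable_abs_besselJ_mul_exp x θ

/-- Pointwise decay in the centre-of-mass direction passes to the coefficients in the Stark
basis. -/
theorem norm_inner_starkBasis_le {N : ℕ} {g h θ C : ℝ} {lam : ℂ} {ψ : HilbertSpace N}
    (hθ : 0 ≤ θ) (hC : 0 ≤ C) (hψ : ∀ j, ‖ψ j‖ ≤ C * Real.exp (-θ * comDist h lam j))
    (m : Config N) :
    ‖inner ℂ ψ (starkBasis g h m)‖ ≤
      C * (∑' n : Config N, ∏ i, (|besselJ (n i) (g / h)| * Real.exp (θ * |(n i : ℝ)|))) *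
        Real.exp (-θ * comDist h lam m) := by
  have hs := ((Equiv.subLeft m).hasSum_iff.2
    (summable_prod_besselJ_mul_exp N (g / h) θ).hasSum).mul_left
      (C * Real.exp (-θ * comDist h lam m))
  rw [lp.inner_eq_tsum, mul_right_comm]
  refine tsum_of_norm_bounded hs fun j => ?_
  have hexp : Real.exp (-θ * comDist h lam j) ≤
      Real.exp (-θ * comDist h lam m) * ∏ i, Real.exp (θ * |((m i - j i : ℤ) : ℝ)|) := by
    rw [← Real.exp_sum, ← Real.exp_add, Real.exp_le_exp, ← Finset.mul_sum]
    have := mul_le_mul_of_nonneg_left (comDist_le_add_sum_abs_sub h lam j m) hθ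
    linarith
  have hb : ‖(starkBasis g h m : Config N → ℂ) j‖ = ∏ i, |besselJ (m i - j i) (g / h)| := by
    simp [starkBasis, tensorVec, starkVec, norm_prod]
  calc ‖inner ℂ (ψ j) ((starkBasis g h m : Config N → ℂ) j)‖
      ≤ ‖ψ j‖ * ‖(starkBasis g h m : Config N → ℂ) j‖ := norm_inner_le_norm _ _
    _ ≤ (C * (Real.exp (-θ * comDist h lam m) * ∏ i, Real.exp (θ * |((m i - j i : ℤ) : ℝ)|))) *
          ∏ i, |besselJ (m i - j i) (g / h)| := by
        rw [hb]
        gcongr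
        exact (hψ j).trans (mul_le_mul_of_nonneg_left hexp hC)
    _ = _ := by
        simp only [Function.comp_apply, Equiv.subLeft_apply, Pi.sub_apply,
          Finset.prod_mul_distrib]
        ring

end StarkFewBody

theorem corollary4 (N : ℕ) (hN : 1 ≤ N) (g h : ℝ) (hh : h ≠ 0) (v : ℤ → ℝ)
    (hv_bdd : ∃ B : ℝ, ∀ n, |v n| ≤ B)
    (hv_lim : Filter.Tendsto v Filter.cofinite (nhds 0)) :
    (∀ θ : ℝ, 0 ≤ θ → ∃ C : ℝ, ∀ (lam : ℂ) (ψ : StarkFewBody.HilbertSpace N),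
      StarkFewBody.IsNormalizedEigenpair g h v lam ψ → ∀ m : Fin N → ℤ,
        ‖inner ℂ ψ (StarkFewBody.starkBasis g h m)‖ ≤
          C * Real.exp (-θ * ‖(∑ i, (m i : ℂ)) + lam / (2 * (h : ℂ))‖)) ∧
    (∀ θ : ℝ, 0 < θ → ∃ C : ℝ, ∀ (lam : ℂ) (ψ : StarkFewBody.HilbertSpace N),
      StarkFewBody.IsNormalizedEigenpair g h v lam ψ → ∀ j : Fin N → ℤ,
        ‖inner ℂ ψ (StarkFewBody.positionBasis j)‖ ≤
          C * Real.exp (-θ * ‖(∑ i, (j i : ℂ)) + lam / (2 * (h : ℂ))‖)) := by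
  open StarkFewBody in
  refine ⟨fun θ hθ => ?_, fun θ hθ => ?_⟩
  · obtain ⟨C, hC, H⟩ := exists_norm_apply_le_exp N g hh hv_bdd hθ
    exact ⟨_, fun lam ψ hψ m => norm_inner_starkBasis_le hθ hC (H lam ψ hψ) m⟩
  · obtain ⟨C, -, H⟩ := exists_norm_apply_le_exp N g hh hv_bdd hθ.le
    refine ⟨C, fun lam ψ hψ j => ?_⟩
    rw [inner_positionBasis, RCLike.norm_conj]
    exact H lam ψ hψ j
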